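/- Let $Q$ be a smooth $n$-dimensional manifold (Hausdorff, second countable, without boundary), let $\vartheta_0$ be the fundamental one-form on $T^*Q$, let $\omega=d\vartheta_0$, and for $f,g\in C^\infty(T^*Q)$ let $X_f$ be the Hamiltonian vector field, defined by $\omega(X_f,\cdot)=-df$, and $\{f,g\}=-X_f g$ the Poisson bracket. Let $\mathscr{C}\subseteq T^*Q$ be a closed set. A \emph{constraint} is a function $c\in C^\infty(T^*Q)$ with $c|_{\mathscr{C}}=0$; a function $f\in C^\infty(T^*Q)$ is \emph{first class} if $\{f,c\}$ is a constraint for every constraint $c$; a constraint is \emph{second class} if it is not first class. For an open set $U\subseteq T^*Q$, a \emph{Dirac system} on $U$ consists of finitely many first-class constraints $f_1,\dots,f_k$ ($k\ge 0$; they may, but need not, be independent) and second-class constraints $s_1,\dots,s_m$ ($m\ge 0$) such that every constraint $c$ can be written on $U$ as $c=\sum_i a_if_i+\sum_j b_js_j$ with $a_i,b_j\in C^\infty(U)$, and such that the $m\times m$ matrix $S=(\{s_a,s_b\})$ is invertible at every point of $U$. The corresponding \emph{Dirac modification} of $f$ on $U$ is $f-\sum_{j,l}\{f,s_j\}(S^{-1})^{jl}s_l$.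 \textbf{Theorem.} Assume that every point of $\mathscr{C}$ has an open neighbourhood in $T^*Q$ on which there is a Dirac system. Let $f\in C^\infty(T^*Q)$ be such that, for every constraint $c$, $f$ is constant along every integral curve of $X_c$ (defined on an open interval) that is contained in $\mathscr{C}$. Then there is a first-class function $f^*\in C^\infty(T^*Q)$ with $f^*|_{\mathscr{C}}=f|_{\mathscr{C}}$. Moreover $f^*$ can be chosen of the form $f^*=\sum_i\chi_i f_i^*$, where $(\chi_i)$ is a smooth partition of unity on $T^*Q$ subordinate to a family of open sets $U_i$, and $f_i^*$ is the Dirac modification of $f$ on $U_i$ given by a Dirac system on $U_i$. -/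

import Mathlib

open scoped Manifold ContDiff

noncomputable section

namespace DiracConstraints

section CotangentBundle

variable (n : ℕ) (Q : Type*) [TopologicalSpace Q] [ChartedSpace (EuclideanSpace ℝ (Fin n)) Q]
  [IsManifold (𝓡 n) ∞ Q]

/-- The cotangent bundle `T^*Q` of an `n`-dimensional smooth manifold `Q`: a point is a pair
`⟨q, ξ⟩` with `ξ : T_q Q →L[ℝ] ℝ`.  Its topology and its smooth structure are those that Mathlib
puts on the bundle of continuous linear maps from the tangent bundle to the trivial line bundle. -/
abbrev CotangentBundle : Type _ :=
  Bundle.TotalSpace (EuclideanSpace ℝ (Fin n) →L[ℝ] ℝ)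
    (fun q : Q ↦ TangentSpace (𝓡 n) q →L[ℝ] Bundle.Trivial Q ℝ q)

/-- The vector space `ℝⁿ × (ℝⁿ)^*` on which `T^*Q` is modelled. -/
abbrev CotangentModelSpace : Type :=
  EuclideanSpace ℝ (Fin n) × (EuclideanSpace ℝ (Fin n) →L[ℝ] ℝ)

/-- The model with corners (without boundary) of the manifold `T^*Q`. -/
abbrev cotangentModel :
    ModelWithCorners ℝ (CotangentModelSpace n)
      (ModelProd (EuclideanSpace ℝ (Fin n)) (EuclideanSpace ℝ (Fin n) →L[ℝ] ℝ)) :=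
  (𝓡 n).prod 𝓘(ℝ, EuclideanSpace ℝ (Fin n) →L[ℝ] ℝ)

end CotangentBundle

section Symplectic

variable {n : ℕ} {Q : Type*} [TopologicalSpace Q] [ChartedSpace (EuclideanSpace ℝ (Fin n)) Q]
  [IsManifold (𝓡 n) ∞ Q]

/-- The fundamental (tautological) one-form `ϑ₀` on `T^*Q`: `ϑ₀_p(w) = p(dπ_p w)`. -/
def fundamentalOneForm (p : CotangentBundle n Q) : TangentSpace (cotangentModel n) p →L[ℝ] ℝ :=
  ContinuousLinearMap.comp (p.2 : TangentSpace (𝓡 n) p.1 →L[ℝ] ℝ)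
    (mfderiv (cotangentModel n) (𝓡 n)
      (fun x : CotangentBundle n Q ↦ (Bundle.TotalSpace.proj x : Q)) p)

/-- The one-form `ϑ₀` read in the chart of `T^*Q` centred at `p`, that is, its pullback under the
inverse of that chart. -/
def fundamentalOneFormInChart (p : CotangentBundle n Q) (y : CotangentModelSpace n) :
    CotangentModelSpace n →L[ℝ] ℝ :=
  ContinuousLinearMap.comp (fundamentalOneForm ((extChartAt (cotangentModel n) p).symm y))
    (mfderiv 𝓘(ℝ, CotangentModelSpace n) (cotangentModel n)
      (extChartAt (cotangentModel n) p).symm y)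

/-- The canonical symplectic form `ω = dϑ₀` on `T^*Q`: the exterior derivative of `ϑ₀`, computed
at `p` in the chart centred at `p` and pulled back by this chart. -/
def symplecticForm (p : CotangentBundle n Q) :
    TangentSpace (cotangentModel n) p [⋀^Fin 2]→L[ℝ] ℝ :=
  (extDeriv
      (fun y ↦ ContinuousAlternatingMap.ofSubsingleton ℝ (CotangentModelSpace n) ℝ (0 : Fin 1)
        (fundamentalOneFormInChart p y))
      (extChartAt (cotangentModel n) p p)).compContinuousLinearMap
    (mfderiv (cotangentModel n) 𝓘(ℝ, CotangentModelSpace n) (extChartAt (cotangentModel n) p) p)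

/-- In the coordinates `(q, ξ)` of a chart of `T^*Q` one has `ϑ₀ = ξ dq`. -/
theorem fundamentalOneFormInChart_apply (p : CotangentBundle n Q) {y : CotangentModelSpace n}
    (hy : y ∈ (extChartAt (cotangentModel n) p).target) (v : CotangentModelSpace n) :
    fundamentalOneFormInChart p y v = y.2 v.1 := by
  set φ := extChartAt (cotangentModel n) p with hφ
  set ψ := extChartAt (𝓡 n) p.1 with hψ
  have hφx : ∀ x : CotangentBundle n Q, (φ x).1 = ψ x.1 ∧ (φ x).2 =
      ContinuousLinearMap.comp (x.2 : TangentSpace (𝓡 n) x.1 →L[ℝ] ℝ)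
      ((trivializationAt (EuclideanSpace ℝ (Fin n)) (TangentSpace (𝓡 n)) p.1).symmL ℝ x.1) := by
    intro x
    rw [hφ, FiberBundle.extChartAt]
    refine ⟨rfl, ?_⟩
    have := congrArg Prod.snd (hom_trivializationAt_apply (σ := RingHom.id ℝ)
      (F₁ := EuclideanSpace ℝ (Fin n)) (E₁ := fun q : Q ↦ TangentSpace (𝓡 n) q) (F₂ := ℝ)
      (E₂ := Bundle.Trivial Q ℝ) p.1 x)
    refine this.trans ?_
    simp [ContinuousLinearMap.inCoordinates]
  have key : ∀ z ∈ φ.target, (φ.symm z).1 ∈ (chartAt (EuclideanSpace ℝ (Fin n)) p.1).source ∧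
      ψ (φ.symm z).1 = z.1 := by
    intro z hz
    have hx : φ.symm z ∈ φ.source := φ.map_target hz
    have hxy : φ (φ.symm z) = z := φ.right_inv hz
    refine ⟨?_, by rw [← (hφx _).1, hxy]⟩
    generalize φ.symm z = x at hx
    rw [hφ, extChartAt_source, FiberBundle.chartedSpace_chartAt] at hx
    simp only [mfld_simps] at hx
    exact hx.1.1
  have hq := (key y hy).1
  have h1 := (key y hy).2
  have hx : φ.symm y ∈ φ.source := φ.map_target hy
  have hxy : φ (φ.symm y) = y := φ.right_inv hy
  have h2 : ContinuousLinearMap.comp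
      ((φ.symm y).2 : TangentSpace (𝓡 n) (φ.symm y).1 →L[ℝ] ℝ)
      ((trivializationAt (EuclideanSpace ℝ (Fin n)) (TangentSpace (𝓡 n)) p.1).symmL ℝ
        (φ.symm y).1) = y.2 := by
    rw [← (hφx _).2, hxy]
  rw [TangentBundle.symmL_trivializationAt hq, ← hψ, h1, modelWithCornersSelf_coe,
    Set.range_id, mfderivWithin_univ] at h2
  have hmem : φ.target ∈ nhds y := extChartAt_target_mem_nhds' hy
  have h3 : (fun z ↦ (φ.symm z).1) =ᶠ[nhds y] fun z ↦ ψ.symm z.1 := by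
    filter_upwards [hmem] with z hz
    rw [← (key z hz).2, ψ.left_inv]
    rw [hψ, extChartAt_source]
    exact (key z hz).1
  have hy1 : y.1 ∈ ψ.target := by
    rw [← h1]
    exact ψ.map_source (by rw [hψ, extChartAt_source]; exact hq)
  have h4 : mfderiv 𝓘(ℝ, CotangentModelSpace n) (𝓡 n) (fun z ↦ (φ.symm z).1) y
      = (mfderiv 𝓘(ℝ, EuclideanSpace ℝ (Fin n)) (𝓡 n) ψ.symm y.1).comp
        (ContinuousLinearMap.fst ℝ (EuclideanSpace ℝ (Fin n))
          (EuclideanSpace ℝ (Fin n) →L[ℝ] ℝ)) := by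
    rw [h3.mfderiv_eq]
    have hd : MDifferentiableAt 𝓘(ℝ, EuclideanSpace ℝ (Fin n)) (𝓡 n) ψ.symm y.1 := by
      have := mdifferentiableWithinAt_extChartAt_symm (I := 𝓡 n) hy1
      rwa [ModelWithCorners.range_eq_univ, mdifferentiableWithinAt_univ] at this
    have hf : MDifferentiableAt 𝓘(ℝ, CotangentModelSpace n) 𝓘(ℝ, EuclideanSpace ℝ (Fin n))
        (Prod.fst : CotangentModelSpace n → EuclideanSpace ℝ (Fin n)) y :=
      differentiableAt_fst.mdifferentiableAt
    have := mfderiv_comp y hd hf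
    rw [show (fun z : CotangentModelSpace n ↦ ψ.symm z.1) = ψ.symm ∘ Prod.fst from rfl, this,
      mfderiv_eq_fderiv, fderiv_fst]
    rfl
  have hproj : MDifferentiableAt (cotangentModel n) (𝓡 n)
      (fun x : CotangentBundle n Q ↦ (Bundle.TotalSpace.proj x : Q)) (φ.symm y) :=
    (Bundle.contMDiffAt_proj _ (n := 1)).mdifferentiableAt one_ne_zero
  have hsymm : MDifferentiableAt 𝓘(ℝ, CotangentModelSpace n) (cotangentModel n) φ.symm y := by
    have := mdifferentiableWithinAt_extChartAt_symm (I := cotangentModel n) hy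
    rwa [ModelWithCorners.range_eq_univ, mdifferentiableWithinAt_univ] at this
  have h5 := mfderiv_comp y hproj hsymm
  have h6 : mfderiv 𝓘(ℝ, CotangentModelSpace n) (𝓡 n)
      ((fun x : CotangentBundle n Q ↦ (Bundle.TotalSpace.proj x : Q)) ∘ φ.symm) y = _ := h4
  rw [h6] at h5
  have h7 : fundamentalOneFormInChart p y
      = (ContinuousLinearMap.comp ((φ.symm y).2 : TangentSpace (𝓡 n) (φ.symm y).1 →L[ℝ] ℝ)
        ((mfderiv 𝓘(ℝ, EuclideanSpace ℝ (Fin n)) (𝓡 n) ψ.symm y.1).comp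
        (ContinuousLinearMap.fst ℝ (EuclideanSpace ℝ (Fin n))
          (EuclideanSpace ℝ (Fin n) →L[ℝ] ℝ)))) := by
    rw [h5]; rfl
  rw [h7]
  exact congrArg (fun L : EuclideanSpace ℝ (Fin n) →L[ℝ] ℝ ↦ L v.1) h2

/-- The exterior derivative of `ξ dq` on `ℝⁿ × (ℝⁿ)^*` is `dξ ∧ dq`. -/
theorem extDeriv_model (y v w : CotangentModelSpace n) :
    extDeriv (fun y : CotangentModelSpace n ↦
      ContinuousAlternatingMap.ofSubsingleton ℝ (CotangentModelSpace n) ℝ (0 : Fin 1)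
        (y.2.comp (ContinuousLinearMap.fst ℝ _ _))) y ![v, w] = v.2 w.1 - w.2 v.1 := by
  let L : CotangentModelSpace n →L[ℝ] (CotangentModelSpace n [⋀^Fin 1]→L[ℝ] ℝ) :=
    (ContinuousAlternatingMap.ofSubsingletonLIE (𝕜 := ℝ)
      (E := CotangentModelSpace n) (F := ℝ)
        (0 : Fin 1)).toContinuousLinearEquiv.toContinuousLinearMap.comp
      (((ContinuousLinearMap.compL ℝ (CotangentModelSpace n) (EuclideanSpace ℝ (Fin n)) ℝ).flip
        (ContinuousLinearMap.fst ℝ _ _)).comp (ContinuousLinearMap.snd ℝ _ _))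
  have h0 : ∀ a u : CotangentModelSpace n, fderiv ℝ (fun y ↦ L y ![a]) y u = u.2 a.1 := by
    intro a u
    have : (fun y ↦ L y ![a]) = ((ContinuousLinearMap.apply ℝ ℝ a.1).comp
        (ContinuousLinearMap.snd ℝ (EuclideanSpace ℝ (Fin n))
          (EuclideanSpace ℝ (Fin n) →L[ℝ] ℝ)) : CotangentModelSpace n →L[ℝ] ℝ) := by
      ext y; rfl
    rw [this, ContinuousLinearMap.fderiv]
    rfl
  have h1 : Fin.removeNth 0 ![v, w] = ![w] := by ext i : 1; fin_cases i; rfl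
  have h2 : Fin.removeNth 1 ![v, w] = ![v] := by ext i : 1; fin_cases i; rfl
  refine (extDeriv_apply (L.differentiableAt (x := y)) ![v, w]).trans ?_
  rw [Fin.sum_univ_two, h1, h2, h0, h0]
  simp [sub_eq_add_neg]

/-- In the coordinates `(q, ξ)` of a chart of `T^*Q` one has `ω = dξ ∧ dq`. -/
theorem symplecticForm_apply (p : CotangentBundle n Q) (v w : CotangentModelSpace n) :
    (symplecticForm p : CotangentModelSpace n [⋀^Fin 2]→L[ℝ] ℝ) ![v, w] =
      v.2 w.1 - w.2 v.1 := by
  have hev : (fun y ↦ ContinuousAlternatingMap.ofSubsingleton ℝ (CotangentModelSpace n) ℝ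
      (0 : Fin 1) (fundamentalOneFormInChart p y)) =ᶠ[nhds (extChartAt (cotangentModel n) p p)]
      fun y ↦ ContinuousAlternatingMap.ofSubsingleton ℝ (CotangentModelSpace n) ℝ (0 : Fin 1)
        (y.2.comp (ContinuousLinearMap.fst ℝ _ _)) := by
    filter_upwards [extChartAt_target_mem_nhds (I := cotangentModel n) p] with y hy
    congr 1
    exact ContinuousLinearMap.ext fun v ↦ fundamentalOneFormInChart_apply p hy v
  rw [symplecticForm, hev.extDeriv_eq, mfderiv_extChartAt_self]
  exact extDeriv_model _ v w

/-- The symplectic form is nondegenerate, so that Hamiltonian vector fields exist and are unique. -/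
theorem existsUnique_hamiltonian (p : CotangentBundle n Q)
    (α : TangentSpace (cotangentModel n) p →L[ℝ] ℝ) :
    ∃! X : TangentSpace (cotangentModel n) p,
      ∀ w : TangentSpace (cotangentModel n) p, symplecticForm p ![X, w] = -α w := by
  let α' : CotangentModelSpace n →L[ℝ] ℝ := α
  suffices h : ∃! X : CotangentModelSpace n, ∀ w : CotangentModelSpace n,
      X.2 w.1 - w.2 X.1 = -α' w by
    simp only [← symplecticForm_apply p] at h
    exact h
  let β : Module.Dual ℝ (Module.Dual ℝ (EuclideanSpace ℝ (Fin n))) :=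
    (α'.comp (ContinuousLinearMap.inr ℝ _ _)).toLinearMap.comp
      (LinearMap.toContinuousLinearMap :
        (EuclideanSpace ℝ (Fin n) →ₗ[ℝ] ℝ) ≃ₗ[ℝ] _).toLinearMap
  obtain ⟨x, hx⟩ := (Module.evalEquiv ℝ (EuclideanSpace ℝ (Fin n))).surjective β
  have hx' : ∀ ξ : EuclideanSpace ℝ (Fin n) →L[ℝ] ℝ, ξ x = α' (0, ξ) := fun ξ ↦
    congrArg (fun b ↦ b ξ.toLinearMap) hx
  have hα : ∀ w : CotangentModelSpace n, α' w = α' (w.1, 0) + α' (0, w.2) := fun w ↦ by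
    rw [← map_add]; simp
  refine ⟨(x, -(α'.comp (ContinuousLinearMap.inl ℝ _ _))), ?_, ?_⟩
  · intro w
    change -α' (w.1, 0) - w.2 x = -α' w
    rw [hα w, hx']
    ring
  · intro Y hY
    refine Prod.ext ?_ ?_
    · refine (Module.evalEquiv ℝ (EuclideanSpace ℝ (Fin n))).injective (LinearMap.ext fun g ↦ ?_)
      have h1 := hY (0, LinearMap.toContinuousLinearMap g)
      have h2 := hx' (LinearMap.toContinuousLinearMap g)
      simp only [map_zero, zero_sub, neg_inj, LinearMap.coe_toContinuousLinearMap'] at h1 h2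
      exact h1.trans h2.symm
    · ext u : 1
      have h1 := hY (u, 0)
      simpa using h1

/-- The Hamiltonian vector field `X_f` of `f`, defined by `X_f ⌟ ω = -df`. -/
def hamiltonianVectorField (f : CotangentBundle n Q → ℝ) (p : CotangentBundle n Q) :
    TangentSpace (cotangentModel n) p :=
  (existsUnique_hamiltonian p (mfderiv (cotangentModel n) 𝓘(ℝ, ℝ) f p)).choose

/-- The Poisson bracket `{f, g} = -X_f g`. -/
def poissonBracket (f g : CotangentBundle n Q → ℝ) (p : CotangentBundle n Q) : ℝ :=
  -(mfderiv (cotangentModel n) 𝓘(ℝ, ℝ) g p (hamiltonianVectorField f p))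

end Symplectic

section Constraints

universe u

variable {n : ℕ} {Q : Type u} [TopologicalSpace Q] [ChartedSpace (EuclideanSpace ℝ (Fin n)) Q]
  [IsManifold (𝓡 n) ∞ Q]

/-- `f ∈ C^∞(T^*Q)`. -/
def IsSmooth (f : CotangentBundle n Q → ℝ) : Prop :=
  ContMDiff (cotangentModel n) 𝓘(ℝ, ℝ) ∞ f

/-- `a` is smooth on the set `U ⊆ T^*Q`. -/
def IsSmoothOn (a : CotangentBundle n Q → ℝ) (U : Set (CotangentBundle n Q)) : Prop :=
  ContMDiffOn (cotangentModel n) 𝓘(ℝ, ℝ) ∞ a U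

/-- `c` is a constraint function, i.e. it belongs to the constraint ideal of `C`: it is smooth on
`T^*Q` and vanishes on `C`. -/
def IsConstraint (C : Set (CotangentBundle n Q)) (c : CotangentBundle n Q → ℝ) : Prop :=
  IsSmooth c ∧ ∀ p ∈ C, c p = 0

/-- `f` is a first class function: its bracket with every constraint is a constraint. -/
def IsFirstClass (C : Set (CotangentBundle n Q)) (f : CotangentBundle n Q → ℝ) : Prop :=
  IsSmooth f ∧ ∀ c, IsConstraint C c → IsConstraint C (poissonBracket f c)

/-- A first class constraint. -/
def IsFirstClassConstraint (C : Set (CotangentBundle n Q)) (c : CotangentBundle n Q → ℝ) : Prop :=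
  IsConstraint C c ∧ IsFirstClass C c

/-- A second class constraint: a constraint that is not first class. -/
def IsSecondClassConstraint (C : Set (CotangentBundle n Q)) (c : CotangentBundle n Q → ℝ) : Prop :=
  IsConstraint C c ∧ ¬ IsFirstClass C c

/-- The matrix `S` of Poisson brackets `S_{ab} = {s_a, s_b}` at the point `p`. -/
def bracketMatrix {m : ℕ} (s : Fin m → CotangentBundle n Q → ℝ) (p : CotangentBundle n Q) :
    Matrix (Fin m) (Fin m) ℝ :=
  Matrix.of fun a b ↦ poissonBracket (s a) (s b) p

/-- The first class constraints `φ₁, …, φ_k` and the second class constraints `s₁, …, s_m`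
generate the restriction to the open set `U` of the constraint ideal of `C`, and the matrix of
the brackets `{s_a, s_b}` is nondegenerate at every point of `U`. -/
structure IsDiracSystemOn (C U : Set (CotangentBundle n Q)) {k m : ℕ}
    (φ : Fin k → CotangentBundle n Q → ℝ) (s : Fin m → CotangentBundle n Q → ℝ) : Prop where
  isOpen : IsOpen U
  firstClass : ∀ i, IsFirstClassConstraint C (φ i)
  secondClass : ∀ j, IsSecondClassConstraint C (s j)
  generate : ∀ c, IsConstraint C c →
    ∃ (a : Fin k → CotangentBundle n Q → ℝ) (b : Fin m → CotangentBundle n Q → ℝ),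
      (∀ i, IsSmoothOn (a i) U) ∧ (∀ j, IsSmoothOn (b j) U) ∧
        ∀ p ∈ U, c p = ∑ i, a i p * φ i p + ∑ j, b j p * s j p
  nondegenerate : ∀ p ∈ U, (bracketMatrix s p).det ≠ 0

/-- The Dirac modification `f - {f, s_j} A^{jl} s_l` of `f`, where `A = S⁻¹`. -/
def diracModification {m : ℕ} (s : Fin m → CotangentBundle n Q → ℝ)
    (f : CotangentBundle n Q → ℝ) (p : CotangentBundle n Q) : ℝ :=
  f p - ∑ j, ∑ l, poissonBracket f (s j) p * (bracketMatrix s p)⁻¹ j l * s l p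

/-- `fstar` is glued from local Dirac modifications of `f`: `fstar = ∑ χ_i f_i^*` for a smooth
partition of unity `(χ_i)` on `T^*Q` subordinate to open sets `U_i`, where `f_i^*` is the Dirac
modification of `f` by the second class constraints of a Dirac system on `U_i`. -/
def IsGluedFromDiracModifications (C : Set (CotangentBundle n Q))
    (f fstar : CotangentBundle n Q → ℝ) : Prop :=
  ∃ (ι : Type u) (χ : SmoothPartitionOfUnity ι (cotangentModel n) (CotangentBundle n Q) Set.univ)
    (U : ι → Set (CotangentBundle n Q)) (k m : ι → ℕ)
    (φ : (i : ι) → Fin (k i) → CotangentBundle n Q → ℝ)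
    (s : (i : ι) → Fin (m i) → CotangentBundle n Q → ℝ),
    χ.IsSubordinate U ∧ (∀ i, IsDiracSystemOn C (U i) (φ i) (s i)) ∧
      ∀ p, fstar p = ∑ᶠ i, χ i p * diracModification (s i) f p

/-- `f` is constant along every integral curve `γ : I → T^*Q` (`I` an open interval) of the
Hamiltonian vector field of a constraint that is contained in `C`. -/
def IsConstantAlongConstraintCurves (C : Set (CotangentBundle n Q))
    (f : CotangentBundle n Q → ℝ) : Prop :=
  ∀ c, IsConstraint C c → ∀ (I : Set ℝ) (γ : ℝ → CotangentBundle n Q),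
    IsOpen I → I.OrdConnected → IsMIntegralCurveOn γ (hamiltonianVectorField c) I →
      (∀ t ∈ I, γ t ∈ C) → ∀ t₁ ∈ I, ∀ t₂ ∈ I, f (γ t₁) = f (γ t₂)

end Constraints

end DiracConstraints

end

open DiracConstraints

/-!
On a neighbourhood `U` with a Dirac system, the Dirac modification is `f` plus a combination of the
second class constraints `s_l`, hence equal to `f` on `C`, and its bracket with every constraint
vanishes on `C ∩ U` (`IsDiracSystemOn.bracket_diracModification_eq_zero`).  By the Leibniz rule at
points of `C`, it suffices to check this on generators.  For the `s_a` it is the choice of the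
coefficients through the inverse of the matrix of brackets.  For a first class constraint `c` it
reduces to `{c, f} = 0` on `C`, which is where the hypothesis on `f` enters: the generators of the
constraint ideal satisfy a homogeneous linear differential equation along an integral curve of
`X_c`, so that such a curve stays in `C` if it starts there
(`IsFirstClass.eventually_mem_of_integralCurve`), and `f` is then constant along it.

The local modifications are glued by a partition of unity on `T^*Q`.  Outside `C` the neighbourhoods
come from the square of a function with zero set `C`, which is a first class constraint and
generates the constraint ideal there (`exists_isDiracSystemOn_of_notMem`).  As `∑ χ_i = 1`, the
glued function is again locally `f` plus a combination of second class constraints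
(`eventually_glued_eq`), and its bracket with a constraint at a point of `C` is a combination of the
brackets of the local modifications.

Smoothness of Poisson brackets and existence of integral curves require the Hamiltonian vector field
in a fixed chart, whereas the symplectic form at `p` is computed in the chart centred at `p`.  The
two agree since the transition maps of `T^*Q` are symplectic (`symplectic_mfderiv_extChartAt`).
-/

noncomputable section

namespace DiracConstraints

open Filter Topology

/-! ### The model symplectic vector space -/

section Model

variable (n : ℕ)

/-- The musical map of the model symplectic space `ℝⁿ × (ℝⁿ)^*`, with the sign convention of
`hamiltonianVectorField`: it sends `X` to the covector `w ↦ -ω(X, w)`. -/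
def modelFlat : CotangentModelSpace n →ₗ[ℝ] (CotangentModelSpace n →L[ℝ] ℝ) where
  toFun X := (ContinuousLinearMap.apply ℝ ℝ X.1).comp (ContinuousLinearMap.snd ℝ _ _) -
    X.2.comp (ContinuousLinearMap.fst ℝ _ _)
  map_add' X Y := by ext w <;> simp; abel
  map_smul' a X := by ext w <;> simp

variable {n}

theorem modelFlat_apply (X w : CotangentModelSpace n) :
    modelFlat n X w = -(X.2 w.1 - w.2 X.1) := by
  simp [modelFlat]

theorem modelFlat_injective : Function.Injective (modelFlat n) := by
  rw [injective_iff_map_eq_zero]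
  intro X hX
  have h : ∀ w : CotangentModelSpace n, X.2 w.1 - w.2 X.1 = 0 := fun w ↦ by
    rw [← neg_eq_zero, ← modelFlat_apply, hX]; rfl
  refine Prod.ext ?_ ?_
  · have h2 := h (0, innerSL ℝ X.1)
    simpa using h2
  · ext u : 1
    simpa using h (u, 0)

variable (n) in
/-- The inverse of `modelFlat`: it sends a covector `α` to the vector `X` with `ω(X, ·) = -α`, that
is, to `X = (∂α/∂ξ, -∂α/∂q)`. -/
def modelSharp : (CotangentModelSpace n →L[ℝ] ℝ) →L[ℝ] CotangentModelSpace n :=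
  ContinuousLinearMap.prod
    (∑ i, (ContinuousLinearMap.apply ℝ ℝ
      ((0, EuclideanSpace.proj i) : CotangentModelSpace n)).smulRight
        (EuclideanSpace.single i (1 : ℝ)))
    (-(ContinuousLinearMap.compL ℝ (EuclideanSpace ℝ (Fin n)) (CotangentModelSpace n) ℝ).flip
      (ContinuousLinearMap.inl ℝ _ _))

theorem modelSharp_spec (α : CotangentModelSpace n →L[ℝ] ℝ) (w : CotangentModelSpace n) :
    (modelSharp n α).2 w.1 - w.2 (modelSharp n α).1 = -α w := by
  have h1 : (modelSharp n α).2 w.1 = -α (w.1, 0) := rfl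
  have h2 : (modelSharp n α).1 =
      ∑ i, α (0, EuclideanSpace.proj i) • EuclideanSpace.single i (1 : ℝ) := by
    simp [modelSharp]
  have h3 : ((0, w.2) : CotangentModelSpace n) =
      ∑ i, w.2 (EuclideanSpace.single i (1 : ℝ)) •
        ((0, EuclideanSpace.proj i) : CotangentModelSpace n) := by
    refine Prod.ext (by simp [Prod.fst_sum]) ?_
    ext u : 1
    conv_lhs => rw [← (EuclideanSpace.basisFun (Fin n) ℝ).sum_repr u]
    simp [Prod.snd_sum, mul_comm]
  have h4 : w.2 (modelSharp n α).1 = α (0, w.2) := by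
    rw [h2, h3, map_sum, map_sum]
    refine Finset.sum_congr rfl fun i _ ↦ ?_
    rw [map_smul, map_smul, smul_eq_mul, smul_eq_mul, mul_comm]
  have h5 : α w = α (w.1, 0) + α (0, w.2) := by
    rw [← map_add]; simp
  rw [h1, h4, h5]
  ring

theorem eq_modelSharp {α : CotangentModelSpace n →L[ℝ] ℝ} {X : CotangentModelSpace n}
    (h : ∀ w : CotangentModelSpace n, X.2 w.1 - w.2 X.1 = -α w) : X = modelSharp n α := by
  refine modelFlat_injective (ContinuousLinearMap.ext fun w ↦ ?_)
  rw [modelFlat_apply, modelFlat_apply, h, modelSharp_spec]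

theorem modelSharp_antisymm (α β : CotangentModelSpace n →L[ℝ] ℝ) :
    β (modelSharp n α) = -α (modelSharp n β) := by
  have h1 := modelSharp_spec α (modelSharp n β)
  have h2 := modelSharp_spec β (modelSharp n α)
  linarith

end Model

/-! ### Symplectic transition maps -/

section Charts

variable {n : ℕ} {Q : Type*} [TopologicalSpace Q] [ChartedSpace (EuclideanSpace ℝ (Fin n)) Q]
  [IsManifold (𝓡 n) ∞ Q]

theorem hamiltonianVectorField_eq (f : CotangentBundle n Q → ℝ) (p : CotangentBundle n Q) :
    hamiltonianVectorField f p = modelSharp n (mfderiv (cotangentModel n) 𝓘(ℝ, ℝ) f p) :=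
  eq_modelSharp fun w ↦ by
    refine (symplecticForm_apply p _ w).symm.trans ?_
    exact (existsUnique_hamiltonian p (mfderiv (cotangentModel n) 𝓘(ℝ, ℝ) f p)).choose_spec.1 w

theorem mdifferentiableAt_extChartAt_symm_cotangent (p₀ : CotangentBundle n Q)
    {z : CotangentModelSpace n} (hz : z ∈ (extChartAt (cotangentModel n) p₀).target) :
    MDifferentiableAt 𝓘(ℝ, CotangentModelSpace n) (cotangentModel n)
      (extChartAt (cotangentModel n) p₀).symm z := by
  have := mdifferentiableWithinAt_extChartAt_symm (I := cotangentModel n) hz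
  rwa [ModelWithCorners.range_eq_univ, mdifferentiableWithinAt_univ] at this

/-- The transition maps between the charts of `T^*Q` are symplectic, since each chart turns the
fundamental one-form into `ξ dq` and the exterior derivative commutes with pullback.  The derivative
of the chart is passed as an endomorphism `T` of the model space, with which each tangent space of
`T^*Q` is identified through its preferred chart. -/
theorem symplectic_mfderiv_extChartAt (p₀ : CotangentBundle n Q) {p : CotangentBundle n Q}
    (hp : p ∈ (extChartAt (cotangentModel n) p₀).source)
    (T : CotangentModelSpace n →L[ℝ] CotangentModelSpace n)
    (hT : T = mfderiv (cotangentModel n) 𝓘(ℝ, CotangentModelSpace n)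
      (extChartAt (cotangentModel n) p₀) p) (v w : CotangentModelSpace n) :
    (T v).2 (T w).1 - (T w).2 (T v).1 = v.2 w.1 - w.2 v.1 := by
  set φ := extChartAt (cotangentModel n) p₀ with hφ
  set ψ := extChartAt (cotangentModel n) p with hψ
  set τ : CotangentModelSpace n → CotangentModelSpace n := φ ∘ ψ.symm with hτ
  have hψp : ψ.symm (ψ p) = p := extChartAt_to_inv (I := cotangentModel n) p
  have hcont : ContinuousAt ψ.symm (ψ p) := continuousAt_extChartAt_symm p
  have hev : ∀ᶠ z in 𝓝 (ψ p), z ∈ ψ.target ∧ ψ.symm z ∈ φ.source :=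
    Filter.Eventually.and (extChartAt_target_mem_nhds (I := cotangentModel n) p)
      (hcont (by rw [hψp]; exact extChartAt_source_mem_nhds' hp))
  have hτsm : ContDiffAt ℝ ∞ τ (ψ p) := by
    have h1 := contMDiffOn_extChartAt_symm (I := cotangentModel n) (n := ∞) p
    have h2 : ContMDiffAt (cotangentModel n) 𝓘(ℝ, CotangentModelSpace n) ∞ φ p :=
      contMDiffAt_extChartAt' (by rwa [hφ, extChartAt_source] at hp)
    have h3 : ContMDiffAt 𝓘(ℝ, CotangentModelSpace n) (cotangentModel n) ∞ ψ.symm (ψ p) :=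
      h1.contMDiffAt (extChartAt_target_mem_nhds p)
    exact (ContMDiffAt.comp (ψ p) (by rwa [hψp]) h3).contDiffAt
  have hTτ : T = fderiv ℝ τ (ψ p) := by
    have h : MDifferentiableAt (cotangentModel n) 𝓘(ℝ, CotangentModelSpace n) φ p :=
      mdifferentiableAt_extChartAt (by rwa [hφ, extChartAt_source] at hp)
    refine (hT.trans h.mfderiv).trans ?_
    rw [ModelWithCorners.range_eq_univ, fderivWithin_univ]
    rfl
  have hpull : ∀ᶠ z in 𝓝 (ψ p), ∀ u : CotangentModelSpace n,
      z.2 u.1 = (τ z).2 (fderiv ℝ τ z u).1 := by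
    -- both sides are `ϑ₀`, read in the charts centred at `p` and at `p₀`
    filter_upwards [hev.eventually_nhds] with z hz u
    obtain ⟨hz1, hz2⟩ := hz.self_of_nhds
    have h2 : τ z ∈ φ.target := φ.map_source hz2
    rw [← fundamentalOneFormInChart_apply p hz1, ← fundamentalOneFormInChart_apply p₀ h2]
    have hτd : MDifferentiableAt 𝓘(ℝ, CotangentModelSpace n) 𝓘(ℝ, CotangentModelSpace n) τ z :=
      MDifferentiableAt.comp z
        (mdifferentiableAt_extChartAt (by rwa [hφ, extChartAt_source] at hz2))
          (mdifferentiableAt_extChartAt_symm_cotangent p hz1)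
    have heq : (ψ.symm : CotangentModelSpace n → CotangentBundle n Q) =ᶠ[𝓝 z] φ.symm ∘ τ := by
      filter_upwards [hz] with z' hz'
      exact (φ.left_inv hz'.2).symm
    have h3 := mfderiv_comp z (mdifferentiableAt_extChartAt_symm_cotangent p₀ h2) hτd
    have h4 := heq.mfderiv_eq (I := 𝓘(ℝ, CotangentModelSpace n)) (I' := cotangentModel n)
    have h5 : φ.symm (τ z) = ψ.symm z := φ.left_inv hz2
    simp only [fundamentalOneFormInChart]
    rw [mfderiv_eq_fderiv] at h3
    have h6 : (mfderiv 𝓘(ℝ, CotangentModelSpace n) (cotangentModel n) ψ.symm z :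
        CotangentModelSpace n →L[ℝ] CotangentModelSpace n) = (mfderiv 𝓘(ℝ, CotangentModelSpace n)
        (cotangentModel n) φ.symm (τ z) :
        CotangentModelSpace n →L[ℝ] CotangentModelSpace n).comp (fderiv ℝ τ z) := h4.trans h3
    have h7 : ∀ q q' : CotangentBundle n Q, q = q' → ∀ x : CotangentModelSpace n,
        (fundamentalOneForm q : CotangentModelSpace n →L[ℝ] ℝ) x =
        (fundamentalOneForm q' : CotangentModelSpace n →L[ℝ] ℝ) x := by
      rintro q _ rfl x; rfl
    exact (congrArg (fun L : CotangentModelSpace n →L[ℝ] CotangentModelSpace n ↦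
      (fundamentalOneForm (ψ.symm z) : CotangentModelSpace n →L[ℝ] ℝ) (L u)) h6).trans
      (h7 _ _ h5.symm _)
  -- `θ = ξ dq` satisfies `τ^* θ = θ` near `ψ p`, so that `dτ` preserves `dθ`
  let θ : CotangentModelSpace n → CotangentModelSpace n [⋀^Fin 1]→L[ℝ] ℝ := fun y ↦
    ContinuousAlternatingMap.ofSubsingleton ℝ (CotangentModelSpace n) ℝ (0 : Fin 1)
      (y.2.comp (ContinuousLinearMap.fst ℝ _ _))
  have hθ : Differentiable ℝ θ := by
    let L : CotangentModelSpace n →L[ℝ] (CotangentModelSpace n [⋀^Fin 1]→L[ℝ] ℝ) :=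
      (ContinuousAlternatingMap.ofSubsingletonLIE (𝕜 := ℝ)
        (E := CotangentModelSpace n) (F := ℝ)
          (0 : Fin 1)).toContinuousLinearEquiv.toContinuousLinearMap.comp
        (((ContinuousLinearMap.compL ℝ (CotangentModelSpace n) (EuclideanSpace ℝ (Fin n)) ℝ).flip
          (ContinuousLinearMap.fst ℝ _ _)).comp (ContinuousLinearMap.snd ℝ _ _))
    have hL : Differentiable ℝ fun y ↦ L y := by fun_prop
    exact hL
  have hθτ : θ =ᶠ[𝓝 (ψ p)] fun z ↦ (θ (τ z)).compContinuousLinearMap (fderiv ℝ τ z) := by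
    filter_upwards [hpull] with z hz
    ext u
    exact hz (u 0)
  have hd := hθτ.extDeriv_eq.trans
    (extDeriv_pullback (hθ (τ (ψ p))) (hτsm)
      (by simpa using (WithTop.coe_le_coe.2 le_top : ((2 : ℕ∞) : WithTop ℕ∞) ≤ ∞)))
  have hd' := congrArg (fun η : CotangentModelSpace n [⋀^Fin 2]→L[ℝ] ℝ ↦ η ![v, w]) hd
  have hvec : (fderiv ℝ τ (ψ p)) ∘ ![v, w] = ![T v, T w] := by
    rw [hTτ]; ext i : 1; fin_cases i <;> rfl
  simp only [ContinuousAlternatingMap.compContinuousLinearMap_apply, hvec] at hd'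
  rw [extDeriv_model, extDeriv_model] at hd'
  exact hd'.symm

end Charts

/-! ### Poisson brackets and Hamiltonian curves in a chart -/

section Charts

variable {n : ℕ} {Q : Type*} [TopologicalSpace Q] [ChartedSpace (EuclideanSpace ℝ (Fin n)) Q]
  [IsManifold (𝓡 n) ∞ Q]

/-- The function `f` read in the chart of `T^*Q` centred at `p₀`. -/
def inChart (p₀ : CotangentBundle n Q) (f : CotangentBundle n Q → ℝ) :
    CotangentModelSpace n → ℝ :=
  f ∘ (extChartAt (cotangentModel n) p₀).symm

theorem IsSmooth.contDiffOn_inChart {f : CotangentBundle n Q → ℝ} (hf : IsSmooth f)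
    (p₀ : CotangentBundle n Q) :
    ContDiffOn ℝ ∞ (inChart p₀ f) (extChartAt (cotangentModel n) p₀).target :=
  (hf.comp_contMDiffOn (contMDiffOn_extChartAt_symm (I := cotangentModel n) p₀)).contDiffOn

theorem IsSmooth.mdifferentiableAt {f : CotangentBundle n Q → ℝ} (hf : IsSmooth f)
    (p : CotangentBundle n Q) : MDifferentiableAt (cotangentModel n) 𝓘(ℝ, ℝ) f p :=
  (hf p).mdifferentiableAt (by simp)

theorem mfderiv_eq_fderiv_inChart {f : CotangentBundle n Q → ℝ} (hf : IsSmooth f)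
    (p₀ : CotangentBundle n Q) {p : CotangentBundle n Q}
    (hp : p ∈ (extChartAt (cotangentModel n) p₀).source)
    (T : CotangentModelSpace n →L[ℝ] CotangentModelSpace n)
    (hT : T = mfderiv (cotangentModel n) 𝓘(ℝ, CotangentModelSpace n)
      (extChartAt (cotangentModel n) p₀) p) :
    mfderiv (cotangentModel n) 𝓘(ℝ, ℝ) f p =
      (fderiv ℝ (inChart p₀ f) (extChartAt (cotangentModel n) p₀ p)).comp T := by
  have hev : f =ᶠ[𝓝 p] inChart p₀ f ∘ extChartAt (cotangentModel n) p₀ := by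
    filter_upwards [extChartAt_source_mem_nhds' hp] with q hq
    simp only [inChart, Function.comp_apply, PartialEquiv.left_inv _ hq]
  have hF : DifferentiableAt ℝ (inChart p₀ f) (extChartAt (cotangentModel n) p₀ p) :=
    ((hf.contDiffOn_inChart p₀).contDiffAt (extChartAt_target_mem_nhds'
      (PartialEquiv.map_source _ hp))).differentiableAt (by simp)
  rw [hev.mfderiv_eq, hT]
  have h := mfderiv_comp p hF.mdifferentiableAt (mdifferentiableAt_extChartAt
    (I := cotangentModel n) (by rwa [extChartAt_source] at hp))
  rw [mfderiv_eq_fderiv] at h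
  exact h

/-- In every chart, not only in the one centred at `p`, the Hamiltonian vector field is the model
Hamiltonian vector field, because the transition maps are symplectic. -/
theorem mfderiv_extChartAt_hamiltonianVectorField {f : CotangentBundle n Q → ℝ} (hf : IsSmooth f)
    (p₀ : CotangentBundle n Q) {p : CotangentBundle n Q}
    (hp : p ∈ (extChartAt (cotangentModel n) p₀).source)
    (T : CotangentModelSpace n →L[ℝ] CotangentModelSpace n)
    (hT : T = mfderiv (cotangentModel n) 𝓘(ℝ, CotangentModelSpace n)
      (extChartAt (cotangentModel n) p₀) p) :
    T (hamiltonianVectorField f p) =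
      modelSharp n (fderiv ℝ (inChart p₀ f) (extChartAt (cotangentModel n) p₀ p)) := by
  refine eq_modelSharp fun w ↦ ?_
  obtain ⟨u, rfl⟩ : ∃ u, T u = w := by
    have h := (isInvertible_mfderiv_extChartAt (I := cotangentModel n) hp).bijective.2 w
    rw [hT]; exact h
  rw [hamiltonianVectorField_eq]
  refine (symplectic_mfderiv_extChartAt p₀ hp T hT _ _).trans ((modelSharp_spec _ _).trans ?_)
  rw [mfderiv_eq_fderiv_inChart hf p₀ hp T hT]
  rfl

/-- The Poisson bracket is computed by the same formula in every chart of `T^*Q`. -/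
theorem poissonBracket_eq_inChart {f g : CotangentBundle n Q → ℝ} (hf : IsSmooth f)
    (hg : IsSmooth g) (p₀ : CotangentBundle n Q) {p : CotangentBundle n Q}
    (hp : p ∈ (extChartAt (cotangentModel n) p₀).source) :
    poissonBracket f g p =
      -fderiv ℝ (inChart p₀ g) (extChartAt (cotangentModel n) p₀ p)
        (modelSharp n (fderiv ℝ (inChart p₀ f) (extChartAt (cotangentModel n) p₀ p))) := by
  rw [poissonBracket, mfderiv_eq_fderiv_inChart hg p₀ hp _ rfl,
    ← mfderiv_extChartAt_hamiltonianVectorField hf p₀ hp _ rfl]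
  rfl

theorem IsSmooth.contDiffOn_fderiv_inChart {f : CotangentBundle n Q → ℝ} (hf : IsSmooth f)
    (p₀ : CotangentBundle n Q) :
    ContDiffOn ℝ ∞ (fderiv ℝ (inChart p₀ f)) (extChartAt (cotangentModel n) p₀).target :=
  (hf.contDiffOn_inChart p₀).fderiv_of_isOpen (isOpen_extChartAt_target p₀) (by simp)

theorem IsSmooth.contDiffOn_modelSharp {f : CotangentBundle n Q → ℝ} (hf : IsSmooth f)
    (p₀ : CotangentBundle n Q) :
    ContDiffOn ℝ ∞ (fun z ↦ modelSharp n (fderiv ℝ (inChart p₀ f) z))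
      (extChartAt (cotangentModel n) p₀).target := by
  have h : ContDiff ℝ ∞ fun α ↦ modelSharp n α := by fun_prop
  exact h.comp_contDiffOn (hf.contDiffOn_fderiv_inChart p₀)

theorem IsSmooth.poissonBracket {f g : CotangentBundle n Q → ℝ} (hf : IsSmooth f)
    (hg : IsSmooth g) : IsSmooth (poissonBracket f g) := by
  intro p₀
  have h1 : ContDiffOn ℝ ∞ (fun z ↦ -fderiv ℝ (inChart p₀ g) z
      (modelSharp n (fderiv ℝ (inChart p₀ f) z))) (extChartAt (cotangentModel n) p₀).target :=
    ((hg.contDiffOn_fderiv_inChart p₀).clm_apply (hf.contDiffOn_modelSharp p₀)).neg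
  have h2 : ContMDiffAt (cotangentModel n) 𝓘(ℝ, ℝ) ∞ ((fun z ↦ -fderiv ℝ (inChart p₀ g) z
      (modelSharp n (fderiv ℝ (inChart p₀ f) z))) ∘ extChartAt (cotangentModel n) p₀) p₀ :=
    ((h1.contDiffAt (extChartAt_target_mem_nhds p₀)).contMDiffAt).comp p₀ contMDiffAt_extChartAt
  refine h2.congr_of_eventuallyEq ?_
  filter_upwards [extChartAt_source_mem_nhds (I := cotangentModel n) p₀] with p hp
  exact poissonBracket_eq_inChart hf hg p₀ hp

/-- Picard–Lindelöf for the Hamiltonian vector field, solved in the chart centred at `p`. -/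
theorem exists_integralCurve_hamiltonian {f : CotangentBundle n Q → ℝ} (hf : IsSmooth f)
    (p : CotangentBundle n Q) : ∃ γ : ℝ → CotangentBundle n Q, γ 0 = p ∧
      IsMIntegralCurveAt γ (hamiltonianVectorField f) 0 := by
  set φ := extChartAt (cotangentModel n) p with hφ
  have hv : ContDiffAt ℝ 1 (fun z ↦ modelSharp n (fderiv ℝ (inChart p f) z)) (φ p) :=
    ((hf.contDiffOn_modelSharp p).contDiffAt (extChartAt_target_mem_nhds p)).of_le (by simp)
  obtain ⟨y, hy0, ε, hε, hy⟩ :=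
    hv.exists_forall_mem_closedBall_exists_eq_forall_mem_Ioo_hasDerivAt₀ 0
  have hmem : ∀ᶠ t in 𝓝 (0 : ℝ), t ∈ Set.Ioo (0 - ε) (0 + ε) :=
    Ioo_mem_nhds (by linarith) (by linarith)
  have hyc : ContinuousAt y 0 := (hy 0 (by constructor <;> linarith)).continuousAt
  have htar : ∀ᶠ t in 𝓝 (0 : ℝ), y t ∈ φ.target :=
    hyc (by rw [hy0]; exact extChartAt_target_mem_nhds p)
  refine ⟨φ.symm ∘ y, (congrArg φ.symm hy0).trans (extChartAt_to_inv p), ?_⟩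
  filter_upwards [hmem, htar] with t ht1 ht2
  have hsrc : φ.symm (y t) ∈ φ.source := φ.map_target ht2
  have hright : φ (φ.symm (y t)) = y t := φ.right_inv ht2
  have h1 := (mdifferentiableAt_extChartAt_symm_cotangent p ht2).hasMFDerivAt
  have h2 := (hy t ht1).hasFDerivAt.hasMFDerivAt
  refine (h1.comp t h2).congr_mfderiv ?_
  have hX := mfderiv_extChartAt_hamiltonianVectorField hf p hsrc _ rfl
  rw [← hφ, hright] at hX
  have hinv := mfderivWithin_extChartAt_symm_comp_mfderiv_extChartAt (I := cotangentModel n) ht2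
  rw [ModelWithCorners.range_eq_univ, mfderivWithin_univ] at hinv
  have hX' := congrArg (fun L : CotangentModelSpace n →L[ℝ] CotangentModelSpace n ↦
    L (hamiltonianVectorField f (φ.symm (y t)))) hinv
  -- `dφ⁻¹` sends the model vector `dφ(X_f)` back to `X_f`
  ext
  refine (congrArg (fun x : CotangentModelSpace n ↦
    (mfderiv 𝓘(ℝ, CotangentModelSpace n) (cotangentModel n) φ.symm (y t) :
      CotangentModelSpace n →L[ℝ] CotangentModelSpace n) ((1 : ℝ) • x)) hX.symm).trans ?_
  rw [one_smul]
  exact hX'.trans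
    (one_smul ℝ (hamiltonianVectorField f (φ.symm (y t)) : CotangentModelSpace n)).symm

end Charts

/-! ### Topology of the cotangent bundle -/

section Topology

theorem t2Space_totalSpace {B F : Type*} {E : B → Type*} [TopologicalSpace B] [TopologicalSpace F]
    [TopologicalSpace (Bundle.TotalSpace F E)] [∀ x, TopologicalSpace (E x)] [FiberBundle F E]
    [T2Space B] [T2Space F] : T2Space (Bundle.TotalSpace F E) := by
  refine ⟨fun x y hxy ↦ ?_⟩
  by_cases h : x.proj = y.proj
  · set e := trivializationAt F E x.proj
    have hx : x ∈ e.source := FiberBundle.mem_trivializationAt_proj_source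
    have hy : y ∈ e.source := by
      rw [e.mem_source, ← h]
      exact FiberBundle.mem_baseSet_trivializationAt' _
    have hne : e x ≠ e y := fun he ↦ hxy (e.injOn hx hy he)
    obtain ⟨u, v, hu, hv, hxu, hyv, huv⟩ := t2_separation hne
    refine ⟨e.source ∩ e ⁻¹' u, e.source ∩ e ⁻¹' v,
      e.continuousOn.isOpen_inter_preimage e.open_source hu,
      e.continuousOn.isOpen_inter_preimage e.open_source hv, ⟨hx, hxu⟩, ⟨hy, hyv⟩, ?_⟩
    exact (huv.preimage e).mono Set.inter_subset_right Set.inter_subset_right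
  · exact separated_by_continuous (FiberBundle.continuous_proj F E) h

theorem secondCountableTopology_totalSpace {B F : Type*} {E : B → Type*} [TopologicalSpace B]
    [TopologicalSpace F] [TopologicalSpace (Bundle.TotalSpace F E)] [∀ x, TopologicalSpace (E x)]
    [FiberBundle F E] [SecondCountableTopology B] [SecondCountableTopology F] :
    SecondCountableTopology (Bundle.TotalSpace F E) := by
  obtain ⟨s, hs, hsU⟩ := TopologicalSpace.countable_cover_nhds (α := B)
    (f := fun b ↦ (trivializationAt F E b).baseSet) fun b ↦
      (trivializationAt F E b).open_baseSet.mem_nhds (FiberBundle.mem_baseSet_trivializationAt' b)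
  have : Countable s := hs.to_subtype
  have : ∀ b : s, SecondCountableTopology (trivializationAt F E (b : B)).source := fun b ↦
    (trivializationAt F E (b : B)).toOpenPartialHomeomorph.secondCountableTopology_source
  refine TopologicalSpace.secondCountableTopology_of_countable_cover
    (fun b : s ↦ (trivializationAt F E (b : B)).open_source) ?_
  refine Set.eq_univ_of_forall fun x ↦ ?_
  obtain ⟨b, hb, hxb⟩ := Set.mem_iUnion₂.1 (hsU.ge (Set.mem_univ x.proj))
  exact Set.mem_iUnion.2 ⟨⟨b, hb⟩, (Bundle.Trivialization.mem_source _).2 hxb⟩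

variable {n : ℕ} {Q : Type*} [TopologicalSpace Q] [ChartedSpace (EuclideanSpace ℝ (Fin n)) Q]
  [IsManifold (𝓡 n) ∞ Q]

instance [T2Space Q] : T2Space (CotangentBundle n Q) := t2Space_totalSpace

instance [SecondCountableTopology Q] : SigmaCompactSpace (CotangentBundle n Q) := by
  have : SecondCountableTopology (EuclideanSpace ℝ (Fin n) →L[ℝ] ℝ) :=
    secondCountable_of_proper
  have : SecondCountableTopology (CotangentBundle n Q) := secondCountableTopology_totalSpace
  have : LocallyCompactSpace (CotangentBundle n Q) :=
    Manifold.locallyCompact_of_finiteDimensional (cotangentModel n)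
  infer_instance

/-- Every closed subset of `T^*Q` is the zero set of a constraint. -/
theorem exists_isConstraint_zeroSet [T2Space Q] [SecondCountableTopology Q]
    {C : Set (CotangentBundle n Q)} (hC : IsClosed C) :
    ∃ c, IsConstraint C c ∧ ∀ p, c p = 0 → p ∈ C := by
  obtain ⟨c, hsupp, hc, -⟩ :=
    hC.isOpen_compl.exists_contMDiff_support_eq (cotangentModel n) (n := ⊤)
  have h : ∀ p, c p = 0 ↔ p ∈ C := fun p ↦ by
    rw [← Function.notMem_support, hsupp, Set.notMem_compl_iff]
  exact ⟨c, ⟨hc, fun p hp ↦ (h p).2 hp⟩, fun p ↦ (h p).1⟩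

end Topology

/-! ### Homogeneous linear differential equations -/

section ODE

/-- A solution of a homogeneous linear differential equation that vanishes at time `0` vanishes
near time `0`. -/
theorem eventually_eq_zero_of_linear_ode {ι : Type*} [Fintype ι] {A : ℝ → ι → ι → ℝ}
    {x : ℝ → ι → ℝ} (hA : ∀ i j, ContinuousAt (fun t ↦ A t i j) 0)
    (hx : ∀ᶠ t in 𝓝 0, HasDerivAt x (fun i ↦ ∑ j, A t i j * x t j) t) (h0 : x 0 = 0) :
    ∀ᶠ t in 𝓝 0, x t = 0 := by
  have hB : ∀ᶠ t in 𝓝 (0 : ℝ), ∀ i j, |A t i j| ≤ |A 0 i j| + 1 := by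
    refine eventually_all.2 fun i ↦ eventually_all.2 fun j ↦ ?_
    exact ((hA i j).abs.eventually_lt continuousAt_const (by simp)).mono fun t ht ↦ ht.le
  set K : ℝ := ∑ i, ∑ j, (|A 0 i j| + 1) with hK
  have hK0 : 0 ≤ K := by positivity
  have hlip : ∀ᶠ t in 𝓝 (0 : ℝ), LipschitzOnWith K.toNNReal
      (fun (y : ι → ℝ) i ↦ ∑ j, A t i j * y j) Set.univ := by
    filter_upwards [hB] with t ht
    refine LipschitzOnWith.of_dist_le_mul fun y _ z _ ↦ ?_
    rw [Real.coe_toNNReal _ hK0]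
    refine (dist_pi_le_iff (by positivity)).2 fun i ↦ ?_
    calc dist (∑ j, A t i j * y j) (∑ j, A t i j * z j)
        ≤ ∑ j, |A t i j| * |y j - z j| := by
          rw [Real.dist_eq, ← Finset.sum_sub_distrib]
          refine (Finset.abs_sum_le_sum_abs _ _).trans_eq (Finset.sum_congr rfl fun j _ ↦ ?_)
          rw [← mul_sub, abs_mul]
      _ ≤ ∑ j, (|A 0 i j| + 1) * dist y z := by
          refine Finset.sum_le_sum fun j _ ↦ ?_
          have : |y j - z j| ≤ dist y z := dist_le_pi_dist y z j
          gcongr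
          exact ht i j
      _ ≤ K * dist y z := by
          rw [← Finset.sum_mul]
          gcongr
          exact Finset.single_le_sum (f := fun i ↦ ∑ j, (|A 0 i j| + 1))
            (fun i _ ↦ by positivity) (Finset.mem_univ i)
  refine ODE_solution_unique_of_eventually (f := x) (g := fun _ ↦ 0) hlip
    (hx.mono fun t ht ↦ ⟨ht, Set.mem_univ _⟩) ?_ h0
  refine Eventually.of_forall fun t ↦ ⟨?_, Set.mem_univ _⟩
  have : (fun i ↦ ∑ j, A t i j * (0 : ι → ℝ) j) = 0 := by ext i; simp
  rw [this]
  exact hasDerivAt_const t _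

end ODE

/-! ### The Leibniz rule on the constraint set -/

section Bracket

variable {n : ℕ} {Q : Type*} [TopologicalSpace Q] [ChartedSpace (EuclideanSpace ℝ (Fin n)) Q]
  [IsManifold (𝓡 n) ∞ Q]

theorem poissonBracket_antisymm (f g : CotangentBundle n Q → ℝ) (p : CotangentBundle n Q) :
    poissonBracket f g p = -poissonBracket g f p := by
  rw [poissonBracket, poissonBracket, hamiltonianVectorField_eq, hamiltonianVectorField_eq]
  exact congrArg Neg.neg (modelSharp_antisymm _ _)

/-- The Leibniz rule at a point where the functions `g i` vanish. -/
theorem poissonBracket_of_eventuallyEq {ι : Type*} {F : Finset ι}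
    {f f₀ h : CotangentBundle n Q → ℝ} {a g : ι → CotangentBundle n Q → ℝ}
    {p : CotangentBundle n Q} (hf : IsSmooth f) (hf₀ : IsSmooth f₀) (hh : IsSmooth h)
    (hg : ∀ i ∈ F, IsSmooth (g i))
    (ha : ∀ i ∈ F, ContMDiffAt (cotangentModel n) 𝓘(ℝ, ℝ) ∞ (a i) p)
    (hgp : ∀ i ∈ F, g i p = 0) (heq : ∀ᶠ q in 𝓝 p, f q = f₀ q + ∑ i ∈ F, a i q * g i q) :
    poissonBracket f h p = poissonBracket f₀ h p + ∑ i ∈ F, a i p * poissonBracket (g i) h p := by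
  set φ := extChartAt (cotangentModel n) p with hφ
  have hp : p ∈ φ.source := mem_extChartAt_source p
  have hinv : φ.symm (φ p) = p := extChartAt_to_inv (I := cotangentModel n) p
  have hsymm : ContMDiffAt 𝓘(ℝ, CotangentModelSpace n) (cotangentModel n) ∞ φ.symm (φ p) :=
    (contMDiffOn_extChartAt_symm p).contMDiffAt (extChartAt_target_mem_nhds p)
  have hdiff : ∀ u : CotangentBundle n Q → ℝ, ContMDiffAt (cotangentModel n) 𝓘(ℝ, ℝ) ∞ u p →
      HasFDerivAt (inChart p u) (fderiv ℝ (inChart p u) (φ p)) (φ p) := fun u hu ↦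
    ((ContMDiffAt.comp (φ p) (by rwa [hinv]) hsymm).contDiffAt.differentiableAt
      (by simp)).hasFDerivAt
  have hval : ∀ u : CotangentBundle n Q → ℝ, inChart p u (φ p) = u p := fun u ↦
    congrArg u hinv
  have hev : inChart p f =ᶠ[𝓝 (φ p)]
      fun z ↦ inChart p f₀ z + ∑ i ∈ F, inChart p (a i) z * inChart p (g i) z :=
    hsymm.continuousAt (by rw [hinv]; exact heq)
  have hD : fderiv ℝ (inChart p f) (φ p) = fderiv ℝ (inChart p f₀) (φ p) +
      ∑ i ∈ F, a i p • fderiv ℝ (inChart p (g i)) (φ p) := by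
    rw [hev.fderiv_eq]
    refine HasFDerivAt.fderiv ((hdiff f₀ (hf₀ p)).add (HasFDerivAt.fun_sum fun i hi ↦ ?_))
    refine ((hdiff _ (ha i hi)).mul (hdiff _ (hg i hi p))).congr_fderiv ?_
    rw [hval, hval, hgp i hi, zero_smul, add_zero]
  rw [poissonBracket_eq_inChart hf hh p hp, poissonBracket_eq_inChart hf₀ hh p hp, ← hφ, hD,
    map_add, map_add, map_sum, map_sum, neg_add, ← Finset.sum_neg_distrib]
  congr 1
  refine Finset.sum_congr rfl fun i hi ↦ ?_
  rw [poissonBracket_eq_inChart (hg i hi) hh p hp, map_smul, map_smul, smul_eq_mul, mul_neg]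

theorem isSmooth_const (c : ℝ) : IsSmooth fun _ : CotangentBundle n Q ↦ c :=
  contMDiff_const

theorem poissonBracket_const_left (c : ℝ) (h : CotangentBundle n Q → ℝ)
    (p : CotangentBundle n Q) : poissonBracket (fun _ ↦ c) h p = 0 := by
  have h0 : mfderiv (cotangentModel n) 𝓘(ℝ, ℝ) (fun _ : CotangentBundle n Q ↦ c) p = 0 :=
    mfderiv_const
  rw [poissonBracket_antisymm, neg_eq_zero, ← neg_zero (G := ℝ)]
  exact congrArg (fun L : CotangentModelSpace n →L[ℝ] ℝ ↦ -L (hamiltonianVectorField h p)) h0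

/-- Near a point of `C`, the bracket of a constraint with a function is determined by the brackets
of generators of the constraint ideal. -/
theorem poissonBracket_right_of_eventuallyEq_sum {ι : Type*} [Fintype ι]
    {c h : CotangentBundle n Q → ℝ} {a g : ι → CotangentBundle n Q → ℝ}
    {p : CotangentBundle n Q} (hc : IsSmooth c) (hh : IsSmooth h) (hg : ∀ i, IsSmooth (g i))
    (ha : ∀ i, ContMDiffAt (cotangentModel n) 𝓘(ℝ, ℝ) ∞ (a i) p)
    (hgp : ∀ i, g i p = 0) (heq : ∀ᶠ q in 𝓝 p, c q = ∑ i, a i q * g i q) :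
    poissonBracket h c p = ∑ i, a i p * poissonBracket h (g i) p := by
  rw [poissonBracket_antisymm, poissonBracket_of_eventuallyEq (f₀ := fun _ ↦ 0) hc
    (isSmooth_const 0) hh (fun i _ ↦ hg i) (fun i _ ↦ ha i) (fun i _ ↦ hgp i)
    (by simpa using heq), poissonBracket_const_left, zero_add, ← Finset.sum_neg_distrib]
  refine Finset.sum_congr rfl fun i _ ↦ ?_
  rw [poissonBracket_antisymm (g i) h, mul_neg, neg_neg]

end Bracket

/-! ### First class flows preserve the constraint set -/

section Flow

universe u

variable {n : ℕ} {Q : Type u} [TopologicalSpace Q] [ChartedSpace (EuclideanSpace ℝ (Fin n)) Q]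
  [IsManifold (𝓡 n) ∞ Q] {C U : Set (CotangentBundle n Q)}

/-- The constraints of a Dirac system as a single family of generators of the constraint ideal. -/
theorem IsDiracSystemOn.exists_eq_sum {k m : ℕ} {φ : Fin k → CotangentBundle n Q → ℝ}
    {s : Fin m → CotangentBundle n Q → ℝ} (hD : IsDiracSystemOn C U φ s)
    {c : CotangentBundle n Q → ℝ} (hc : IsConstraint C c) :
    ∃ a : Fin k ⊕ Fin m → CotangentBundle n Q → ℝ, (∀ i, IsSmoothOn (a i) U) ∧
      ∀ p ∈ U, c p = ∑ i, a i p * (Sum.elim φ s i) p := by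
  obtain ⟨a, b, ha, hb, hab⟩ := hD.generate c hc
  refine ⟨Sum.elim a b, ?_, fun p hp ↦ ?_⟩
  · rintro (i | j)
    exacts [ha i, hb j]
  · simp [hab p hp]

theorem IsDiracSystemOn.isConstraint {k m : ℕ} {φ : Fin k → CotangentBundle n Q → ℝ}
    {s : Fin m → CotangentBundle n Q → ℝ} (hD : IsDiracSystemOn C U φ s) (i : Fin k ⊕ Fin m) :
    IsConstraint C (Sum.elim φ s i) := by
  obtain i | j := i
  exacts [(hD.firstClass i).1, (hD.secondClass j).1]

theorem IsSmoothOn.contMDiffAt {a : CotangentBundle n Q → ℝ} (ha : IsSmoothOn a U)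
    (hU : IsOpen U) {p : CotangentBundle n Q} (hp : p ∈ U) :
    ContMDiffAt (cotangentModel n) 𝓘(ℝ, ℝ) ∞ a p :=
  ContMDiffOn.contMDiffAt ha (hU.mem_nhds hp)

theorem IsMIntegralCurveAt.hasDerivAt_comp {f g : CotangentBundle n Q → ℝ} (hg : IsSmooth g)
    {γ : ℝ → CotangentBundle n Q} (hγ : IsMIntegralCurveAt γ (hamiltonianVectorField f) 0) :
    ∀ᶠ t in 𝓝 0, HasDerivAt (g ∘ γ) (-poissonBracket f g (γ t)) t := by
  filter_upwards [hγ] with t ht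
  let L : CotangentModelSpace n →L[ℝ] ℝ := mfderiv (cotangentModel n) 𝓘(ℝ, ℝ) g (γ t)
  let X : CotangentModelSpace n := hamiltonianVectorField f (γ t)
  have h : HasFDerivAt (g ∘ γ) (L.comp ((1 : ℝ →L[ℝ] ℝ).smulRight X)) t :=
    ((hg.mdifferentiableAt (γ t)).hasMFDerivAt.comp t ht).hasFDerivAt
  have hLX : -poissonBracket f g (γ t) = L X := neg_neg (L X)
  rw [hLX]
  simpa using h.hasDerivAt

/-- The Hamiltonian flow of a first class function preserves the constraint set locally: the
brackets of the function with generators of the constraint ideal are combinations of these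
generators, so that the generators solve a homogeneous linear differential equation along each
integral curve. -/
theorem IsFirstClass.eventually_mem_of_integralCurve [T2Space Q] [SecondCountableTopology Q]
    (hC : IsClosed C) {k m : ℕ} {φ : Fin k → CotangentBundle n Q → ℝ}
    {s : Fin m → CotangentBundle n Q → ℝ} (hD : IsDiracSystemOn C U φ s)
    {f : CotangentBundle n Q → ℝ} (hf : IsFirstClass C f) {γ : ℝ → CotangentBundle n Q}
    (hγ : IsMIntegralCurveAt γ (hamiltonianVectorField f) 0) (hγC : γ 0 ∈ C) (hγU : γ 0 ∈ U) :
    ∀ᶠ t in 𝓝 0, γ t ∈ C := by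
  set g := Sum.elim φ s with hg
  have hgc : ∀ i, IsConstraint C (g i) := hD.isConstraint
  choose a ha hag using fun i ↦ hD.exists_eq_sum (hf.2 _ (hgc i))
  have hcont : ContinuousAt γ 0 := hγ.continuousAt
  have hU : ∀ᶠ t in 𝓝 0, γ t ∈ U := hcont (hD.isOpen.mem_nhds hγU)
  have hzero : ∀ᶠ t in 𝓝 0, (fun i ↦ g i (γ t)) = 0 := by
    refine eventually_eq_zero_of_linear_ode (A := fun t i j ↦ -a i j (γ t)) ?_ ?_ ?_
    · intro i j
      exact (ContinuousAt.comp (g := a i j) ((ha i j).contMDiffAt hD.isOpen hγU).continuousAt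
        hcont).neg
    · filter_upwards [hU, eventually_all.2 fun i ↦
        IsMIntegralCurveAt.hasDerivAt_comp (hgc i).1 hγ] with t htU ht
      refine hasDerivAt_pi.2 fun i ↦ (ht i).congr_deriv ?_
      rw [hag i _ htU, ← Finset.sum_neg_distrib]
      exact Finset.sum_congr rfl fun j _ ↦ (neg_mul _ _).symm
    · ext i
      exact (hgc i).2 _ hγC
  obtain ⟨c, hc, hcC⟩ := exists_isConstraint_zeroSet hC
  obtain ⟨b, -, hb⟩ := hD.exists_eq_sum hc
  filter_upwards [hU, hzero] with t htU ht
  refine hcC _ ((hb _ htU).trans (Finset.sum_eq_zero fun i _ ↦ ?_))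
  have : g i (γ t) = 0 := congrFun ht i
  rw [← hg, this, mul_zero]

/-- A function that is constant along the constraint curves in `C` commutes on `C` with the first
class constraints. -/
theorem IsConstantAlongConstraintCurves.poissonBracket_eq_zero [T2Space Q]
    [SecondCountableTopology Q] (hC : IsClosed C) {k m : ℕ}
    {φ : Fin k → CotangentBundle n Q → ℝ} {s : Fin m → CotangentBundle n Q → ℝ}
    (hD : IsDiracSystemOn C U φ s) {f : CotangentBundle n Q → ℝ} (hf : IsSmooth f)
    (hconst : IsConstantAlongConstraintCurves C f) {c : CotangentBundle n Q → ℝ}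
    (hc : IsFirstClassConstraint C c) {p : CotangentBundle n Q} (hpC : p ∈ C) (hpU : p ∈ U) :
    poissonBracket c f p = 0 := by
  obtain ⟨γ, hγ0, hγ⟩ := exists_integralCurve_hamiltonian hc.1.1 p
  have hmem := hc.2.eventually_mem_of_integralCurve hC hD hγ (hγ0 ▸ hpC) (hγ0 ▸ hpU)
  obtain ⟨ε, hε, hball⟩ := Metric.eventually_nhds_iff_ball.1 (hγ.and hmem)
  have hfγ : f ∘ γ =ᶠ[𝓝 0] fun _ ↦ f p := by
    filter_upwards [Metric.ball_mem_nhds (0 : ℝ) hε] with t ht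
    have := hconst c hc.1 (Metric.ball 0 ε) γ Metric.isOpen_ball
      (convex_ball (0 : ℝ) ε).ordConnected
      (fun t ht ↦ (hball t ht).1.hasMFDerivWithinAt) (fun t ht ↦ (hball t ht).2)
      t ht 0 (Metric.mem_ball_self hε)
    rwa [hγ0] at this
  have hder := (IsMIntegralCurveAt.hasDerivAt_comp hf hγ).self_of_nhds
  have h0 := hder.unique ((hasDerivAt_const (0 : ℝ) (f p)).congr_of_eventuallyEq hfγ)
  rw [hγ0] at h0
  exact neg_eq_zero.1 h0

end Flow

/-! ### The Dirac modification -/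

section Modification

universe u

variable {n : ℕ} {Q : Type u} [TopologicalSpace Q] [ChartedSpace (EuclideanSpace ℝ (Fin n)) Q]
  [IsManifold (𝓡 n) ∞ Q] {C U : Set (CotangentBundle n Q)}

theorem isSmoothOn_det {m : ℕ} {A : CotangentBundle n Q → Matrix (Fin m) (Fin m) ℝ}
    (hA : ∀ i j, IsSmoothOn (fun p ↦ A p i j) U) : IsSmoothOn (fun p ↦ (A p).det) U := by
  simp only [Matrix.det_apply']
  exact contMDiffOn_finsetSum fun σ _ ↦
    contMDiffOn_const.mul (contMDiffOn_finsetProd fun i _ ↦ hA _ _)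

theorem isSmoothOn_inv {m : ℕ} {A : CotangentBundle n Q → Matrix (Fin m) (Fin m) ℝ}
    (hA : ∀ i j, IsSmoothOn (fun p ↦ A p i j) U) (hdet : ∀ p ∈ U, (A p).det ≠ 0)
    (i j : Fin m) : IsSmoothOn (fun p ↦ (A p)⁻¹ i j) U := by
  simp only [Matrix.inv_def, Matrix.smul_apply, Ring.inverse_eq_inv', smul_eq_mul,
    Matrix.adjugate_apply]
  refine ContMDiffOn.mul ((isSmoothOn_det hA).inv₀ hdet) (isSmoothOn_det fun k l ↦ ?_)
  by_cases hk : k = j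
  · subst hk
    simp only [Matrix.updateRow_self]
    exact contMDiffOn_const
  · simpa [Matrix.updateRow_ne hk] using hA k l

/-- The coefficient of `s l` in the Dirac modification of `f`. -/
def diracCoefficient {m : ℕ} (s : Fin m → CotangentBundle n Q → ℝ)
    (f : CotangentBundle n Q → ℝ) (l : Fin m) (p : CotangentBundle n Q) : ℝ :=
  -∑ j, poissonBracket f (s j) p * (bracketMatrix s p)⁻¹ j l

theorem diracModification_eq {m : ℕ} (s : Fin m → CotangentBundle n Q → ℝ)
    (f : CotangentBundle n Q → ℝ) (p : CotangentBundle n Q) :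
    diracModification s f p = f p + ∑ l, diracCoefficient s f l p * s l p := by
  rw [diracModification, Finset.sum_comm, sub_eq_add_neg, ← Finset.sum_neg_distrib]
  congr 1
  refine Finset.sum_congr rfl fun l _ ↦ ?_
  rw [diracCoefficient, neg_mul, Finset.sum_mul]

variable {k m : ℕ} {φ : Fin k → CotangentBundle n Q → ℝ} {s : Fin m → CotangentBundle n Q → ℝ}
  {f : CotangentBundle n Q → ℝ}

theorem IsDiracSystemOn.isSmoothOn_diracCoefficient (hD : IsDiracSystemOn C U φ s)
    (hf : IsSmooth f) (l : Fin m) : IsSmoothOn (diracCoefficient s f l) U := by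
  have hs : ∀ j, IsSmooth (s j) := fun j ↦ (hD.secondClass j).1.1
  refine ContMDiffOn.neg (contMDiffOn_finsetSum fun j _ ↦ ?_)
  exact ((hf.poissonBracket (hs j)).contMDiffOn).mul
    (isSmoothOn_inv (fun i j ↦ ((hs i).poissonBracket (hs j)).contMDiffOn) hD.nondegenerate j l)

theorem IsDiracSystemOn.isSmoothOn_diracModification (hD : IsDiracSystemOn C U φ s)
    (hf : IsSmooth f) : IsSmoothOn (diracModification s f) U := by
  have h : IsSmoothOn (fun p ↦ f p + ∑ l, diracCoefficient s f l p * s l p) U :=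
    hf.contMDiffOn.add (contMDiffOn_finsetSum fun l _ ↦
      (hD.isSmoothOn_diracCoefficient hf l).mul (hD.secondClass l).1.1.contMDiffOn)
  exact h.congr fun p _ ↦ diracModification_eq s f p

/-- The left-hand side is the bracket of the Dirac modification of `f` with `c`, expanded at a
point of `C`. -/
theorem IsDiracSystemOn.bracket_diracModification_eq_zero [T2Space Q] [SecondCountableTopology Q]
    (hC : IsClosed C) (hD : IsDiracSystemOn C U φ s) (hf : IsSmooth f)
    (hconst : IsConstantAlongConstraintCurves C f) {c : CotangentBundle n Q → ℝ}
    (hc : IsConstraint C c) {p : CotangentBundle n Q} (hpC : p ∈ C) (hpU : p ∈ U) :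
    poissonBracket f c p + ∑ l, diracCoefficient s f l p * poissonBracket (s l) c p = 0 := by
  have hs : ∀ j, IsSmooth (s j) := fun j ↦ (hD.secondClass j).1.1
  -- the claim for the generators of the constraint ideal
  have hgen : ∀ i, poissonBracket f (Sum.elim φ s i) p +
      ∑ l, diracCoefficient s f l p * poissonBracket (s l) (Sum.elim φ s i) p = 0 := by
    rintro (i | a)
    · have h1 : poissonBracket f (φ i) p = 0 := by
        rw [poissonBracket_antisymm, hconst.poissonBracket_eq_zero hC hD hf (hD.firstClass i)
          hpC hpU, neg_zero]
      have h2 : ∀ l, poissonBracket (s l) (φ i) p = 0 := fun l ↦ by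
        rw [poissonBracket_antisymm, ((hD.firstClass i).2.2 _ (hD.secondClass l).1).2 p hpC,
          neg_zero]
      simp [h1, h2]
    · have hinv : (bracketMatrix s p)⁻¹ * bracketMatrix s p = 1 :=
        Matrix.nonsing_inv_mul _ (hD.nondegenerate p hpU).isUnit
      have h1 : ∑ l, diracCoefficient s f l p * poissonBracket (s l) (s a) p =
          -∑ j, poissonBracket f (s j) p * ((bracketMatrix s p)⁻¹ * bracketMatrix s p) j a := by
        simp only [diracCoefficient, neg_mul, Finset.sum_neg_distrib, Finset.sum_mul,
          Matrix.mul_apply, Finset.mul_sum]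
        rw [Finset.sum_comm]
        simp only [bracketMatrix, Matrix.of_apply, mul_assoc]
      simp [h1, hinv, Matrix.one_apply]
  obtain ⟨a, ha, hca⟩ := hD.exists_eq_sum hc
  have hexp : ∀ h, IsSmooth h →
      poissonBracket h c p = ∑ i, a i p * poissonBracket h (Sum.elim φ s i) p := fun h hh ↦
    poissonBracket_right_of_eventuallyEq_sum hc.1 hh (fun i ↦ (hD.isConstraint i).1)
      (fun i ↦ (ha i).contMDiffAt hD.isOpen hpU) (fun i ↦ (hD.isConstraint i).2 p hpC)
      (by filter_upwards [hD.isOpen.mem_nhds hpU] with q hq using hca q hq)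
  simp only [hexp f hf, hexp _ (hs _), Finset.mul_sum]
  rw [Finset.sum_comm, ← Finset.sum_add_distrib]
  refine Finset.sum_eq_zero fun i _ ↦ ?_
  rw [← mul_zero (a i p), ← hgen i, mul_add, Finset.mul_sum]
  congr 1
  exact Finset.sum_congr rfl fun l _ ↦ mul_left_comm _ _ _

/-- Away from `C` the square of a constraint without zeros is a Dirac system by itself; it is first
class because its differential vanishes on `C`. -/
theorem exists_isDiracSystemOn_of_notMem [T2Space Q] [SecondCountableTopology Q]
    (hC : IsClosed C) {p : CotangentBundle n Q} (hp : p ∉ C) :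
    ∃ (U : Set (CotangentBundle n Q)) (k m : ℕ) (φ : Fin k → CotangentBundle n Q → ℝ)
      (s : Fin m → CotangentBundle n Q → ℝ), p ∈ U ∧ IsDiracSystemOn C U φ s := by
  obtain ⟨g, hg, hgC⟩ := exists_isConstraint_zeroSet hC
  have hg2 : IsSmooth fun q ↦ g q * g q := hg.1.mul hg.1
  have hcon : IsConstraint C fun q ↦ g q * g q := ⟨hg2, fun q hq ↦ by simp [hg.2 q hq]⟩
  refine ⟨{q | g q ≠ 0}, 1, 0, fun _ q ↦ g q * g q, Fin.elim0, fun h ↦ hp (hgC p h), ?_, ?_,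
    fun j ↦ j.elim0, ?_, ?_⟩
  · exact isOpen_ne_fun hg.1.continuous continuous_const
  · refine fun _ ↦ ⟨hcon, hg2, fun c hc ↦ ⟨hg2.poissonBracket hc.1, fun q hq ↦ ?_⟩⟩
    rw [poissonBracket_of_eventuallyEq (F := {()}) (f₀ := fun _ ↦ 0) (a := fun _ ↦ g)
      (g := fun _ ↦ g) hg2 (isSmooth_const 0) hc.1 (fun _ _ ↦ hg.1) (fun _ _ ↦ hg.1 q)
      (fun _ _ ↦ hg.2 q hq) (by simp), poissonBracket_const_left]
    simp [hg.2 q hq]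
  · intro c hc
    refine ⟨fun _ q ↦ c q * (g q * g q)⁻¹, Fin.elim0, fun _ ↦ ?_, fun j ↦ j.elim0, ?_⟩
    · exact ContMDiffOn.mul hc.1.contMDiffOn
        (ContMDiffOn.inv₀ hg2.contMDiffOn fun q hq ↦ mul_ne_zero hq hq)
    · intro q hq
      have : g q * g q ≠ 0 := mul_ne_zero hq hq
      rw [Fin.sum_univ_one, Fin.sum_univ_zero, add_zero, inv_mul_cancel_right₀ this]
  · intro q _
    simp

end Modification

/-! ### Gluing Dirac modifications -/

section Gluing

universe u

variable {n : ℕ} {Q : Type u} [TopologicalSpace Q] [ChartedSpace (EuclideanSpace ℝ (Fin n)) Q]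
  [IsManifold (𝓡 n) ∞ Q] {C : Set (CotangentBundle n Q)} {f : CotangentBundle n Q → ℝ} {ι : Type u}
  {χ : SmoothPartitionOfUnity ι (cotangentModel n) (CotangentBundle n Q) Set.univ}
  {U : ι → Set (CotangentBundle n Q)} {k m : ι → ℕ}
  {φ : (i : ι) → Fin (k i) → CotangentBundle n Q → ℝ}
  {s : (i : ι) → Fin (m i) → CotangentBundle n Q → ℝ}

/-- Since `∑ χ_i = 1`, the glued function differs from `f` locally by a finite combination of second
class constraints; this form of it avoids the derivatives of the `χ_i`. -/
theorem eventually_glued_eq (p : CotangentBundle n Q) :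
    ∀ᶠ q in 𝓝 p, ∑ᶠ i, χ i q * diracModification (s i) f q =
      f q + ∑ x ∈ (χ.fintsupport p).sigma fun i ↦ (Finset.univ : Finset (Fin (m i))),
        χ x.1 q * diracCoefficient (s x.1) f x.2 q * s x.1 x.2 q := by
  filter_upwards [χ.eventually_finsupport_subset p] with q hq
  have hsum : ∑ i ∈ χ.fintsupport p, χ i q = 1 := χ.sum_finsupport' q (Set.mem_univ q) hq
  rw [finsum_eq_sum_of_support_subset (s := χ.fintsupport p), Finset.sum_sigma]
  · simp only [diracModification_eq, mul_add, Finset.sum_add_distrib, ← Finset.sum_mul, hsum,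
      one_mul, Finset.mul_sum, mul_assoc]
  · refine (Function.support_mul_subset_left _ _).trans ?_
    rw [← χ.coe_finsupport]
    exact_mod_cast hq

/-- The bracket of the glued function with a constraint at a point `p` of `C` is the combination
with weights `χ_i(p)` of the brackets of the local Dirac modifications, which vanish. -/
theorem isFirstClass_glued [T2Space Q] [SecondCountableTopology Q] (hC : IsClosed C)
    (hχ : χ.IsSubordinate U)
    (hD : ∀ i, IsDiracSystemOn C (U i) (φ i) (s i)) (hf : IsSmooth f)
    (hconst : IsConstantAlongConstraintCurves C f) :
    IsFirstClass C fun p ↦ ∑ᶠ i, χ i p * diracModification (s i) f p := by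
  have hsm : IsSmooth fun p ↦ ∑ᶠ i, χ i p * diracModification (s i) f p :=
    hχ.contMDiff_finsum_smul (fun i ↦ (hD i).isOpen)
      fun i ↦ (hD i).isSmoothOn_diracModification hf
  refine ⟨hsm, fun c hc ↦ ⟨hsm.poissonBracket hc.1, fun p hp ↦ ?_⟩⟩
  have hmem : ∀ i ∈ χ.fintsupport p, p ∈ U i := fun i hi ↦
    hχ i ((χ.mem_fintsupport_iff p i).1 hi)
  rw [poissonBracket_of_eventuallyEq hsm hf hc.1 (fun x _ ↦ ((hD x.1).secondClass x.2).1.1)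
    (fun x hx ↦ ContMDiffAt.mul ((χ x.1).contMDiff p)
      (((hD x.1).isSmoothOn_diracCoefficient hf x.2).contMDiffAt (hD x.1).isOpen
        (hmem _ (Finset.mem_sigma.1 hx).1)))
    (fun x _ ↦ ((hD x.1).secondClass x.2).1.2 p hp) (eventually_glued_eq p), Finset.sum_sigma]
  have hsum : ∑ i ∈ χ.fintsupport p, χ i p = 1 :=
    χ.sum_finsupport' p (Set.mem_univ p) (χ.finsupport_subset_fintsupport p)
  calc poissonBracket f c p + ∑ i ∈ χ.fintsupport p, ∑ l,
        χ i p * diracCoefficient (s i) f l p * poissonBracket (s i l) c p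
      = ∑ i ∈ χ.fintsupport p, χ i p * (poissonBracket f c p +
          ∑ l, diracCoefficient (s i) f l p * poissonBracket (s i l) c p) := by
        simp only [mul_add, Finset.sum_add_distrib, ← Finset.sum_mul, hsum, one_mul,
          Finset.mul_sum, mul_assoc]
    _ = 0 := Finset.sum_eq_zero fun i hi ↦ by
        rw [(hD i).bracket_diracModification_eq_zero hC hf hconst hc hp (hmem i hi), mul_zero]

end Gluing

end DiracConstraints

end

theorem mainTheorem2 {n : ℕ} {Q : Type*} [TopologicalSpace Q] [T2Space Q]
    [SecondCountableTopology Q] [ChartedSpace (EuclideanSpace ℝ (Fin n)) Q]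
    [IsManifold (𝓡 n) ∞ Q]
    (C : Set (CotangentBundle n Q)) (hC : IsClosed C)
    (hgen : ∀ p ∈ C, ∃ (U : Set (CotangentBundle n Q)) (k m : ℕ)
      (φ : Fin k → CotangentBundle n Q → ℝ) (s : Fin m → CotangentBundle n Q → ℝ),
      p ∈ U ∧ IsDiracSystemOn C U φ s)
    (f : CotangentBundle n Q → ℝ) (hf : IsSmooth f)
    (hconst : IsConstantAlongConstraintCurves C f) :
    ∃ fstar : CotangentBundle n Q → ℝ,
      IsFirstClass C fstar ∧ (∀ p ∈ C, fstar p = f p) ∧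
        IsGluedFromDiracModifications C f fstar := by
  -- a Dirac system is also needed around the points outside `C`, to cover all of `T^*Q`
  have hall : ∀ p : CotangentBundle n Q, ∃ (U : Set (CotangentBundle n Q)) (k m : ℕ)
      (φ : Fin k → CotangentBundle n Q → ℝ) (s : Fin m → CotangentBundle n Q → ℝ),
      p ∈ U ∧ IsDiracSystemOn C U φ s := fun p ↦
    (em (p ∈ C)).elim (hgen p) (exists_isDiracSystemOn_of_notMem hC)
  choose U k m φ s hpU hD using hall
  obtain ⟨χ, hχ⟩ := SmoothPartitionOfUnity.exists_isSubordinate (cotangentModel n)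
    isClosed_univ U (fun p ↦ (hD p).isOpen) fun p _ ↦ Set.mem_iUnion.2 ⟨p, hpU p⟩
  refine ⟨fun p ↦ ∑ᶠ i, χ i p * diracModification (s i) f p,
    isFirstClass_glued hC hχ hD hf hconst, fun p hp ↦ ?_,
    CotangentBundle n Q, χ, U, k, m, φ, s, hχ, hD, fun _ ↦ rfl⟩
  refine (eventually_glued_eq (χ := χ) (s := s) (f := f) p).self_of_nhds.trans ?_
  rw [add_eq_left]
  refine Finset.sum_eq_zero fun x _ ↦ ?_
  rw [((hD x.1).secondClass x.2).1.2 p hp, mul_zero]
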